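/- For a Borel probability measure $\mu$ on $\mathbb{R}^d$, let $C_p(\mu)\in[0,\infty]$ denote its Poincaré constant, i.e. the smallest constant $C\in[0,\infty)$ such that $$\operatorname{Var}_\mu(f)\le C\int_{\mathbb{R}^d}|\nabla f|^2\,d\mu$$ for all locally Lipschitz $f:\mathbb{R}^d\to\mathbb{R}$ that are differentiable $\mu$-almost everywhere (every locally Lipschitz $f$, if $\mu$ is absolutely continuous with respect to Lebesgue measure), where $\operatorname{Var}_\mu(f)=\infty$ if $f\notin L^2(\mu)$; and $C_p(\mu)=\infty$ if there is no such $C$. Let $$\sigma^2(\mu):=\sup_{\alpha\in\mathbb{R}^d,\ |\alpha|=1}\operatorname{Var}_\mu(x\mapsto\alpha\cdot x)\in[0,\infty]$$ be the largest variance of $\mu$ in any direction. Let $X_1,X_2$ be i.i.d. random vectors in $\mathbb{R}^d$ with law $\nu_1$, and let $\nu_2$ be the law of the standardized sum $\frac{1}{\sqrt2}(X_1+X_2)$. Then $\sigma^2(\nu_2)=\sigma^2(\nu_1)$; write $\sigma^2$ for this common value. If $C_p(\nu_1)<\infty$, then $C_p(\nu_2)$ and $\sigma^2$ are finite and $$C_p(\nu_2)\le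 C_p(\nu_1)-\frac{C_p(\nu_1)}{4}\,\frac{(C_p(\nu_2)-\sigma^2)^2}{(C_p(\nu_2)-\sigma^2)^2+C_p(\nu_2)\sigma^2},$$ where the fraction is read as $0$ if its denominator vanishes. -/

import Mathlib

open MeasureTheory ProbabilityTheory
open scoped NNReal ENNReal RealInnerProductSpace Gradient

noncomputable section

/-- `μ` satisfies a Poincaré inequality with constant `C`: `Var_μ(f) ≤ C ∫ |∇f|² dμ` for all
locally Lipschitz `f : ℝᵈ → ℝ` whose usual gradient exists `μ`-almost everywhere, which is what
gives a meaning to the right-hand side. (If `μ` is absolutely continuous with respect to Lebesgue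
measure, Rademacher's theorem says that every locally Lipschitz `f` is such a function.)
Both sides take values in `[0, ∞]`; the variance of a function that is not in `L²(μ)` is `∞`. -/
def SatisfiesPoincare {d : ℕ} (μ : Measure (EuclideanSpace ℝ (Fin d))) (C : ℝ≥0) : Prop :=
  ∀ f : EuclideanSpace ℝ (Fin d) → ℝ, LocallyLipschitz f →
    (∀ᵐ x ∂μ, DifferentiableAt ℝ f x) →
      evariance f μ ≤ (C : ℝ≥0∞) * ∫⁻ x, ‖∇ f x‖ₑ ^ 2 ∂μ

/-- The Poincaré constant `C_p(μ)`: the smallest constant for which `μ` satisfies a Poincaré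
inequality, and `∞` if there is none. -/
def poincareConstant {d : ℕ} (μ : Measure (EuclideanSpace ℝ (Fin d))) : ℝ≥0∞ :=
  ⨅ (C : ℝ≥0) (_ : SatisfiesPoincare μ C), (C : ℝ≥0∞)

/-- `σ²(μ)`: the largest variance of `μ` in any direction, as an element of `[0, ∞]`. -/
def maxDirectionalVariance {d : ℕ} (μ : Measure (EuclideanSpace ℝ (Fin d))) : ℝ≥0∞ :=
  ⨆ (α : EuclideanSpace ℝ (Fin d)) (_ : ‖α‖ = 1), evariance (fun x => ⟪α, x⟫) μ

end

/-! Write `e` and `n` for the mean squared gradient and the squared mean gradient of `f` under `ν₂`.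
Conditioning on `X₁` splits the variance of `f` under `ν₂` in two, and the Poincaré inequality of
`ν₁` applies to each part. The second part involves only the projection of `∇f((x + y)/√2)` onto
functions of `x`. As this kernel is symmetric in `x` and `y`, the projection has energy at most `(e
+ n)/2`, so `Var f ≤ C₁ (3e + n)/4` (`variance_map_const_smul_add_le`). In particular `C₂ ≤ C₁`.

The gain is lost only if `n` is close to `e`. If `f` nearly saturates the inequality of `ν₂`,
perturbing it by `t⟪v, x⟫`, with `v` the mean gradient, forces `Cov(f, ⟪v, ·⟫) ≈ C₂ n`
(`LipschitzPoincare.sq_sub_cov_le`). Cauchy–Schwarz with `Var ⟪v, ·⟫ ≤ σ² n` then bounds `n / e` by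
`σ² / C₂` up to a vanishing error. Hence `4 C₂ ≤ C₁ (3 + σ² / C₂)`, which implies the stated bound.

This is carried out for globally Lipschitz `f`; truncation (`LipschitzPoincare.satisfiesPoincare`)
returns to locally Lipschitz ones. -/

open scoped Topology
open Filter

/-! ### Gradients of real functions. -/

section Gradient

variable {E : Type*} [NormedAddCommGroup E] [InnerProductSpace ℝ E] [CompleteSpace E]

theorem hasGradientAt_inner_const (v x : E) : HasGradientAt (fun y => ⟪v, y⟫) v x := by
  rw [hasGradientAt_iff_hasFDerivAt]
  exact (innerSL ℝ v).hasFDerivAt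

theorem norm_gradient_eq_norm_fderiv (f : E → ℝ) (x : E) : ‖∇ f x‖ = ‖fderiv ℝ f x‖ := by
  simp [gradient]

theorem LipschitzWith.norm_gradient_le {f : E → ℝ} {L : ℝ≥0} (hf : LipschitzWith L f) (x : E) :
    ‖∇ f x‖ ≤ L := by
  rw [norm_gradient_eq_norm_fderiv]
  exact norm_fderiv_le_of_lipschitz ℝ hf

theorem measurable_gradient [MeasurableSpace E] [BorelSpace E] (f : E → ℝ) :
    Measurable (∇ f) :=
  (InnerProductSpace.toDual ℝ E).symm.continuous.measurable.comp (measurable_fderiv ℝ f)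

theorem gradient_const_smul_add (f : E → ℝ) (c : ℝ) (a x : E) :
    ∇ (fun y => f (c • (a + y))) x = c • ∇ f (c • (a + x)) := by
  have h : fderiv ℝ (fun y => f (c • (a + y))) x = c • fderiv ℝ f (c • (a + x)) := by
    rw [fderiv_comp_add_left (f := fun y => f (c • y)) a, fderiv_comp_smul]
  simp only [gradient, h, map_smulₛₗ]
  rfl

end Gradient

theorem LipschitzWith.add_inner_const {E : Type*} [NormedAddCommGroup E]
    [InnerProductSpace ℝ E] {f : E → ℝ} {L : ℝ≥0} (hf : LipschitzWith L f) (v : E) :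
    LipschitzWith (L + ‖v‖₊) (fun x => f x + ⟪v, x⟫) :=
  hf.add ((innerSL ℝ v).lipschitz.weaken (by simp [← NNReal.coe_le_coe]))

/-! ### Second moments and the Poincaré inequality on Lipschitz functions. -/

section Poincare

variable {d : ℕ} {μ : Measure (EuclideanSpace ℝ (Fin d))}

theorem poincareConstant_le {K : ℝ≥0} (h : SatisfiesPoincare μ K) : poincareConstant μ ≤ K :=
  iInf₂_le K h

theorem evariance_inner_le_of_satisfiesPoincare [IsProbabilityMeasure μ] {K : ℝ≥0}
    (h : SatisfiesPoincare μ K) (v : EuclideanSpace ℝ (Fin d)) :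
    evariance (fun x => ⟪v, x⟫) μ ≤ K * ‖v‖ₑ ^ 2 := by
  have hg := hasGradientAt_inner_const v
  refine (h _ (innerSL ℝ v).lipschitz.locallyLipschitz
    (.of_forall fun x => (hg x).differentiableAt)).trans ?_
  simp [fun x => (hg x).gradient]

theorem maxDirectionalVariance_le_of_satisfiesPoincare [IsProbabilityMeasure μ] {K : ℝ≥0}
    (h : SatisfiesPoincare μ K) : maxDirectionalVariance μ ≤ K := by
  refine iSup₂_le fun v hv => (evariance_inner_le_of_satisfiesPoincare h v).trans ?_
  simp [← ofReal_norm, hv]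

/-- Coordinate functions have gradient of norm one, hence finite variance. This makes every
Lipschitz function square integrable. -/
theorem SatisfiesPoincare.memLp_id [IsProbabilityMeasure μ] {K : ℝ≥0}
    (h : SatisfiesPoincare μ K) : MemLp id 2 μ := by
  refine MemLp.of_eval_piLp fun i => ?_
  have h1 := evariance_inner_le_of_satisfiesPoincare h (EuclideanSpace.single i 1)
  have h2 : MemLp (fun x : EuclideanSpace ℝ (Fin d) => ⟪EuclideanSpace.single i (1 : ℝ), x⟫)
      2 μ := by
    rw [← evariance_lt_top_iff_memLp (by fun_prop)]
    exact h1.trans_lt (ENNReal.mul_lt_top (by simp) (by simp))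
  simpa [EuclideanSpace.inner_single_left] using h2

theorem LipschitzWith.memLp_two [IsFiniteMeasure μ] (hμ : MemLp id 2 μ)
    {f : EuclideanSpace ℝ (Fin d) → ℝ} {L : ℝ≥0} (hf : LipschitzWith L f) : MemLp f 2 μ := by
  refine MemLp.of_le ((memLp_const (|f 0|)).add ((hμ.norm).const_mul (L : ℝ)))
    hf.continuous.aestronglyMeasurable (.of_forall fun x => ?_)
  have h1 : |f x - f 0| ≤ L * ‖x‖ := by simpa [Real.dist_eq] using hf.dist_le_mul x 0
  have h2 : |f x| ≤ |f 0| + |f x - f 0| := by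
    simpa using abs_add_le (f 0) (f x - f 0)
  simp only [Pi.add_apply, id, Real.norm_eq_abs]
  exact (h2.trans (by linarith)).trans (le_abs_self _)

theorem LipschitzWith.memLp_gradient [IsFiniteMeasure μ]
    {f : EuclideanSpace ℝ (Fin d) → ℝ} {L : ℝ≥0} (hf : LipschitzWith L f) (p : ℝ≥0∞) :
    MemLp (∇ f) p μ :=
  MemLp.of_bound (measurable_gradient f).aestronglyMeasurable L
    (.of_forall hf.norm_gradient_le)

theorem LipschitzWith.lintegral_enorm_gradient_sq [IsFiniteMeasure μ]
    {f : EuclideanSpace ℝ (Fin d) → ℝ} {L : ℝ≥0} (hf : LipschitzWith L f) :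
    ∫⁻ x, ‖∇ f x‖ₑ ^ 2 ∂μ = ENNReal.ofReal (∫ x, ‖∇ f x‖ ^ 2 ∂μ) := by
  rw [ofReal_integral_eq_lintegral_ofReal
    ((hf.memLp_gradient 2).integrable_norm_pow (by norm_num)) (.of_forall fun x => by positivity)]
  simp [ENNReal.ofReal_pow]

/-- The Poincaré inequality with constant `C`, restricted to globally Lipschitz functions. -/
def LipschitzPoincare (μ : Measure (EuclideanSpace ℝ (Fin d))) (C : ℝ) : Prop :=
  ∀ (f : EuclideanSpace ℝ (Fin d) → ℝ) (L : ℝ≥0), LipschitzWith L f →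
    (∀ᵐ x ∂μ, DifferentiableAt ℝ f x) → variance f μ ≤ C * ∫ x, ‖∇ f x‖ ^ 2 ∂μ

theorem SatisfiesPoincare.lipschitzPoincare [IsProbabilityMeasure μ] {K : ℝ≥0}
    (h : SatisfiesPoincare μ K) : LipschitzPoincare μ K := by
  intro f L hf hd
  have h1 := h f hf.locallyLipschitz hd
  rw [← ofReal_variance (hf.memLp_two h.memLp_id), hf.lintegral_enorm_gradient_sq,
    ← ENNReal.ofReal_coe_nnreal, ← ENNReal.ofReal_mul (by positivity)] at h1
  exact (ENNReal.ofReal_le_ofReal_iff (by positivity)).1 h1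

theorem lipschitzPoincare_poincareConstant [IsProbabilityMeasure μ]
    (h : poincareConstant μ ≠ ∞) : LipschitzPoincare μ (poincareConstant μ).toReal := by
  intro f L hf hd
  set e := ∫ x, ‖∇ f x‖ ^ 2 ∂μ
  have he : 0 ≤ e := by positivity
  refine le_of_forall_pos_le_add fun ε hε => ?_
  -- The slack costs `ε * e / (e + 1) ≤ ε` on the right-hand side; the `+ 1` covers `e = 0`.
  have hlt : poincareConstant μ < ENNReal.ofReal ((poincareConstant μ).toReal + ε / (e + 1)) := by
    conv_lhs => rw [← ENNReal.ofReal_toReal h]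
    exact (ENNReal.ofReal_lt_ofReal_iff (by positivity)).2
      (by linarith [show 0 < ε / (e + 1) by positivity])
  simp only [poincareConstant, iInf_lt_iff] at hlt
  obtain ⟨K, hK, hlt⟩ := hlt
  have h1 := hK.lipschitzPoincare f L hf hd
  have h2 : (K : ℝ) ≤ (poincareConstant μ).toReal + ε / (e + 1) := by
    rw [ENNReal.lt_ofReal_iff_toReal_lt (by simp)] at hlt
    exact hlt.le
  have h3 : ε / (e + 1) * e ≤ ε := by
    rw [div_mul_eq_mul_div, div_le_iff₀ (by positivity)]
    nlinarith
  change variance f μ ≤ K * e at h1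
  nlinarith [mul_le_mul_of_nonneg_right h2 he]

end Poincare

theorem integral_sub_two_mul_add {α : Type*} [MeasurableSpace α] {μ : Measure α} {a b k : α → ℝ}
    (ha : Integrable a μ) (hb : Integrable b μ) (hk : Integrable k μ) :
    ∫ x, (a x - 2 * b x + k x) ∂μ = ∫ x, a x ∂μ - 2 * ∫ x, b x ∂μ + ∫ x, k x ∂μ := by
  rw [← integral_const_mul, ← integral_sub ha (hb.const_mul 2)]
  exact integral_add (ha.sub (hb.const_mul 2)) hk

/-! ### First order projection of a symmetric kernel. -/

section ProjectionBound

variable {α E : Type*} [MeasurableSpace α] {μ : Measure α} [IsProbabilityMeasure μ]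
  [NormedAddCommGroup E] [InnerProductSpace ℝ E] [CompleteSpace E]

theorem integral_norm_sub_integral_sq {u : α → E} (hu : MemLp u 2 μ) :
    ∫ x, ‖u x - ∫ y, u y ∂μ‖ ^ 2 ∂μ = ∫ x, ‖u x‖ ^ 2 ∂μ - ‖∫ x, u x ∂μ‖ ^ 2 := by
  have h1 : Integrable u μ := hu.integrable (by norm_num)
  have h2 : Integrable (fun x => ‖u x‖ ^ 2) μ := hu.integrable_norm_pow (by norm_num)
  have h3 : Integrable (fun x => ⟪u x, ∫ y, u y ∂μ⟫) μ := h1.inner_const _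
  have h4 : ∫ x, ⟪u x, ∫ y, u y ∂μ⟫ ∂μ = ‖∫ x, u x ∂μ‖ ^ 2 := by
    simp_rw [fun x => real_inner_comm (∫ y, u y ∂μ) (u x)]
    rw [integral_inner h1, real_inner_self_eq_norm_sq]
  simp_rw [norm_sub_sq_real]
  rw [integral_sub_two_mul_add h2 h3 (integrable_const _), h4]
  simp
  ring

theorem norm_integral_sq_le {u : α → E} (hu : MemLp u 2 μ) :
    ‖∫ x, u x ∂μ‖ ^ 2 ≤ ∫ x, ‖u x‖ ^ 2 ∂μ := by
  have h := integral_norm_sub_integral_sq hu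
  have h0 : 0 ≤ ∫ x, ‖u x - ∫ y, u y ∂μ‖ ^ 2 ∂μ := by positivity
  linarith

/-- For a bounded symmetric kernel `q`, the squared norm of its first order projection
`x ↦ ∫ q(x, y) dμ(y)` is at most the average of those of `q` and of its mean. -/
theorem two_mul_integral_norm_integral_sq_le {q : α → α → E} {B : ℝ}
    (hm : StronglyMeasurable (Function.uncurry q)) (hB : ∀ x y, ‖q x y‖ ≤ B)
    (hq : ∀ x y, q x y = q y x) :
    2 * ∫ x, ‖∫ y, q x y ∂μ‖ ^ 2 ∂μ ≤
      ∫ x, ∫ y, ‖q x y‖ ^ 2 ∂μ ∂μ + ‖∫ x, ∫ y, q x y ∂μ ∂μ‖ ^ 2 := by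
  set p : α → E := fun x => ∫ y, q x y ∂μ
  have hpm : StronglyMeasurable p := hm.integral_prod_right
  have hpB : ∀ x, ‖p x‖ ≤ B := fun x => by
    simpa using norm_integral_le_of_norm_le_const (μ := μ) (.of_forall (hB x))
  have hpL : MemLp p 2 μ := MemLp.of_bound hpm.aestronglyMeasurable B (.of_forall hpB)
  have hqm : ∀ x, StronglyMeasurable (q x) := fun x => hm.comp_measurable measurable_prodMk_left
  have hqL : ∀ x, MemLp (q x) 2 μ := fun x =>
    MemLp.of_bound (hqm x).aestronglyMeasurable B (.of_forall (hB x))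
  have hp2 : Integrable (fun x => ‖p x‖ ^ 2) μ := hpL.integrable_norm_pow (by norm_num)
  have hq2 : ∀ x, Integrable (fun y => ‖q x y‖ ^ 2) μ := fun x =>
    (hqL x).integrable_norm_pow (by norm_num)
  have hi : Integrable (Function.uncurry fun x y => ⟪q x y, p y⟫) (μ.prod μ) := by
    refine Integrable.of_bound
      (hm.inner (hpm.comp_measurable measurable_snd)).aestronglyMeasurable (B * B)
      (.of_forall fun z => ?_)
    exact (norm_inner_le_norm _ _).trans
      (mul_le_mul (hB _ _) (hpB _) (norm_nonneg _) ((norm_nonneg _).trans (hB z.1 z.2)))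
  have hQ : Integrable (Function.uncurry fun x y => ‖q x y‖ ^ 2) (μ.prod μ) := by
    refine Integrable.of_bound (hm.norm.pow 2).aestronglyMeasurable (B ^ 2)
      (.of_forall fun z => ?_)
    simp only [Function.uncurry, norm_pow, norm_norm]
    exact pow_le_pow_left₀ (norm_nonneg _) (hB _ _) 2
  have hiy : ∀ x, Integrable (fun y => ⟪q x y, p y⟫) μ := fun x => by
    refine Integrable.of_bound ((hqm x).inner hpm).aestronglyMeasurable (B * B)
      (.of_forall fun y => ?_)
    exact (norm_inner_le_norm _ _).trans
      (mul_le_mul (hB _ _) (hpB _) (norm_nonneg _) ((norm_nonneg _).trans (hB x y)))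
  -- Symmetry of `q` enters here: integrating out the first variable also gives `p`.
  have hcross : ∫ x, ∫ y, ⟪q x y, p y⟫ ∂μ ∂μ = ∫ x, ‖p x‖ ^ 2 ∂μ := by
    rw [integral_integral_swap hi]
    congr 1 with y
    simp_rw [real_inner_comm (p y)]
    rw [integral_inner ((hqL y).integrable (by norm_num) |>.congr (.of_forall fun x => hq y x))]
    simp_rw [fun x => hq x y]
    exact real_inner_self_eq_norm_sq _
  -- Jensen for `y ↦ q x y - p y`. Integrated over `x`, the right side becomes `∫∫ ‖q‖² - ∫ ‖p‖²`
  -- and the left `∫ ‖p‖² - ‖∫ p‖²`.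
  have hpt : ∀ x, ‖p x - ∫ y, p y ∂μ‖ ^ 2 ≤
      ∫ y, ‖q x y‖ ^ 2 ∂μ - 2 * ∫ y, ⟪q x y, p y⟫ ∂μ + ∫ y, ‖p y‖ ^ 2 ∂μ := by
    intro x
    have h := norm_integral_sq_le ((hqL x).sub hpL)
    simp only [Pi.sub_apply] at h
    rw [integral_sub ((hqL x).integrable (by norm_num)) (hpL.integrable (by norm_num))] at h
    refine h.trans_eq ?_
    simp_rw [norm_sub_sq_real]
    exact integral_sub_two_mul_add (hq2 x) (hiy x) hp2
  have hI1 := hQ.integral_prod_left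
  have hI2 := hi.integral_prod_left
  simp only [Function.uncurry] at hI1 hI2
  have hmono := integral_mono_of_nonneg (μ := μ) (.of_forall fun x => by positivity)
    ((hI1.sub (hI2.const_mul 2)).add (integrable_const _)) (.of_forall hpt)
  simp only [Pi.sub_apply, Pi.add_apply] at hmono
  rw [integral_norm_sub_integral_sq hpL, integral_sub_two_mul_add hI1 hI2
    (integrable_const _), hcross] at hmono
  simp only [integral_const, probReal_univ, one_smul] at hmono
  linarith

end ProjectionBound

/-! ### Poincaré inequality for a scaled sum of two independent copies. -/

section Convolution

variable {d : ℕ} {μ : Measure (EuclideanSpace ℝ (Fin d))} [IsProbabilityMeasure μ]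

theorem LipschitzWith.comp_const_smul_add {E : Type*} [NormedAddCommGroup E] [NormedSpace ℝ E]
    {f : E → ℝ} {L : ℝ≥0} (hf : LipschitzWith L f) (c : ℝ) (a : E) :
    LipschitzWith (L * ‖c‖₊) (fun y => f (c • (a + y))) := by
  refine hf.comp (LipschitzWith.of_dist_le_mul fun x y => ?_)
  rw [dist_smul₀, dist_add_left]
  rfl

theorem lipschitzWith_integral {α E : Type*} [MeasurableSpace α] [PseudoMetricSpace E]
    {ν : Measure α} [IsProbabilityMeasure ν] {F : E → α → ℝ} {L : ℝ≥0}
    (hi : ∀ x, Integrable (F x) ν) (hF : ∀ a, LipschitzWith L (F · a)) :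
    LipschitzWith L (fun x => ∫ a, F x a ∂ν) := by
  refine LipschitzWith.of_dist_le_mul fun x y => ?_
  rw [dist_eq_norm, ← integral_sub (hi x) (hi y)]
  have h : ∀ a, ‖F x a - F y a‖ ≤ L * dist x y := fun a => (hF a).dist_le_mul x y
  simpa using norm_integral_le_of_norm_le_const (μ := ν) (.of_forall h)

/-- Differentiation under the integral, dominated by the Lipschitz constant. Differentiability for
almost every `y` at the given `x` suffices, so no density is needed. -/
theorem hasGradientAt_integral_const_smul_add (hμ : MemLp id 2 μ)
    {f : EuclideanSpace ℝ (Fin d) → ℝ} {L : ℝ≥0} (hf : LipschitzWith L f) (c : ℝ)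
    {x : EuclideanSpace ℝ (Fin d)}
    (hd : ∀ᵐ y ∂μ, DifferentiableAt ℝ f (c • (x + y))) :
    HasGradientAt (fun x => ∫ y, f (c • (x + y)) ∂μ) (c • ∫ y, ∇ f (c • (x + y)) ∂μ) x := by
  have hsym : ∀ x y, f (c • (x + y)) = f (c • (y + x)) := fun x y => by rw [add_comm]
  have hm : Measurable fun y => c • ∇ f (c • (x + y)) :=
    ((measurable_gradient f).comp (by fun_prop)).const_smul c
  have hint : Integrable (fun y => c • ∇ f (c • (x + y))) μ :=
    Integrable.of_bound hm.aestronglyMeasurable (‖c‖ * L) (.of_forall fun y => by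
      rw [norm_smul]
      exact mul_le_mul_of_nonneg_left (hf.norm_gradient_le _) (norm_nonneg _))
  obtain ⟨hI, hD⟩ := hasFDerivAt_integral_of_dominated_loc_of_lip
    (F := fun x y => f (c • (x + y)))
    (F' := fun y => InnerProductSpace.toDual ℝ _ (c • ∇ f (c • (x + y)))) (μ := μ)
    (bound := fun _ => ((L * ‖c‖₊ : ℝ≥0) : ℝ)) (x₀ := x) Filter.univ_mem
    (.of_forall fun z => (hf.comp_const_smul_add c z).continuous.aestronglyMeasurable)
    (((hf.comp_const_smul_add c x).memLp_two hμ).integrable (by norm_num))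
    ((InnerProductSpace.toDual ℝ _).continuous.measurable.comp hm).aestronglyMeasurable
    (.of_forall fun y => by
      simp_rw [hsym _ y, Real.nnabs_coe]
      exact (hf.comp_const_smul_add c y).lipschitzOnWith)
    (integrable_const _)
    (hd.mono fun y hy => by
      have h1 : DifferentiableAt ℝ (fun x => f (c • (y + x))) x := by
        rw [add_comm] at hy
        exact DifferentiableAt.comp x hy (by fun_prop)
      have h2 := h1.hasGradientAt
      rw [gradient_const_smul_add, hasGradientAt_iff_hasFDerivAt] at h2
      simp_rw [hsym _ y, add_comm x y]
      exact h2)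
  rw [hasGradientAt_iff_hasFDerivAt]
  refine hD.congr_fderiv (ContinuousLinearMap.ext fun w => ?_)
  rw [ContinuousLinearMap.integral_apply hI, InnerProductSpace.toDual_apply_apply,
    ← integral_smul, real_inner_comm, ← integral_inner hint]
  simp_rw [InnerProductSpace.toDual_apply_apply, real_inner_comm w]

theorem map_const_smul_add_memLp_id (hμ : MemLp id 2 μ) (c : ℝ) :
    MemLp id 2 ((μ.prod μ).map fun p => c • (p.1 + p.2)) := by
  rw [memLp_map_measure_iff (by fun_prop) (by fun_prop)]
  exact ((hμ.comp_fst μ).add (hμ.comp_snd μ)).const_smul c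

/-- Law of total variance, conditioning on the first summand. -/
theorem variance_map_const_smul_add (hμ : MemLp id 2 μ)
    {f : EuclideanSpace ℝ (Fin d) → ℝ} {L : ℝ≥0} (hf : LipschitzWith L f) (c : ℝ) :
    variance f ((μ.prod μ).map fun p => c • (p.1 + p.2)) =
      ∫ x, variance (fun y => f (c • (x + y))) μ ∂μ +
        variance (fun x => ∫ y, f (c • (x + y)) ∂μ) μ := by
  have hsec : ∀ x, MemLp (fun y => f (c • (x + y))) 2 μ := fun x =>
    (hf.comp_const_smul_add c x).memLp_two hμ
  have hfm : MemLp f 2 ((μ.prod μ).map fun p => c • (p.1 + p.2)) := by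
    have := Measure.isProbabilityMeasure_map (μ := μ.prod μ)
      (f := fun p => c • (p.1 + p.2)) (by fun_prop)
    exact hf.memLp_two (map_const_smul_add_memLp_id hμ c)
  have hF : MemLp (fun p : _ × _ => f (c • (p.1 + p.2))) 2 (μ.prod μ) :=
    (memLp_map_measure_iff (f := fun p : EuclideanSpace ℝ (Fin d) × EuclideanSpace ℝ (Fin d) =>
      c • (p.1 + p.2)) hf.continuous.aestronglyMeasurable (by fun_prop)).1 hfm
  have hF1 := hF.integrable (by norm_num : (1 : ℝ≥0∞) ≤ 2)
  have hF2 := hF.integrable_sq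
  have hg : MemLp (fun x => ∫ y, f (c • (x + y)) ∂μ) 2 μ :=
    (lipschitzWith_integral (fun x => (hsec x).integrable (by norm_num)) (fun y => by
      simp_rw [fun x => add_comm x y]
      exact hf.comp_const_smul_add c y)).memLp_two hμ
  have := Measure.isProbabilityMeasure_map (μ := μ.prod μ)
    (f := fun p : EuclideanSpace ℝ (Fin d) × EuclideanSpace ℝ (Fin d) => c • (p.1 + p.2))
    (by fun_prop)
  rw [variance_eq_sub hfm, variance_eq_sub hg]
  simp_rw [fun x => variance_eq_sub (hsec x)]
  simp only [Pi.pow_apply]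
  rw [integral_map (f := fun x => f x ^ 2) (by fun_prop)
      (hf.continuous.pow 2).aestronglyMeasurable,
    integral_map (by fun_prop) hf.continuous.aestronglyMeasurable,
    integral_prod _ hF1, integral_prod _ hF2,
    integral_sub hF2.integral_prod_left hg.integrable_sq]
  ring

/-- The Poincaré inequality of `μ` improves, for the law of `c • (X + Y)` with `X, Y` independent
of law `μ`, by the part of the energy of `f` that its mean gradient does not account for. -/
theorem variance_map_const_smul_add_le (hμ : MemLp id 2 μ) {K : ℝ} (hK : LipschitzPoincare μ K)
    (hK0 : 0 ≤ K) {f : EuclideanSpace ℝ (Fin d) → ℝ} {L : ℝ≥0} (hf : LipschitzWith L f) (c : ℝ)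
    {ν : Measure (EuclideanSpace ℝ (Fin d))}
    (hν : ν = (μ.prod μ).map fun p => c • (p.1 + p.2))
    (hd : ∀ᵐ x ∂ν, DifferentiableAt ℝ f x) :
    variance f ν ≤ K * c ^ 2 / 2 * (3 * ∫ x, ‖∇ f x‖ ^ 2 ∂ν + ‖∫ x, ∇ f x ∂ν‖ ^ 2) := by
  set q : EuclideanSpace ℝ (Fin d) → EuclideanSpace ℝ (Fin d) → EuclideanSpace ℝ (Fin d) :=
    fun x y => ∇ f (c • (x + y)) with hq
  have hqm : Measurable (Function.uncurry q) := (measurable_gradient f).comp (by fun_prop)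
  have hqB : ∀ x y, ‖q x y‖ ≤ L := fun x y => hf.norm_gradient_le _
  have hq1 : Integrable (Function.uncurry q) (μ.prod μ) :=
    Integrable.of_bound hqm.aestronglyMeasurable L (.of_forall fun z => hqB _ _)
  have hq2 : Integrable (Function.uncurry fun x y => ‖q x y‖ ^ 2) (μ.prod μ) := by
    refine Integrable.of_bound (hqm.norm.pow_const 2).aestronglyMeasurable (L ^ 2)
      (.of_forall fun z => ?_)
    simp only [Function.uncurry, norm_pow, norm_norm]
    exact pow_le_pow_left₀ (norm_nonneg _) (hqB _ _) 2
  have he : ∫ x, ‖∇ f x‖ ^ 2 ∂ν = ∫ x, ∫ y, ‖q x y‖ ^ 2 ∂μ ∂μ := by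
    rw [hν, integral_map (by fun_prop)
      ((measurable_gradient f).norm.pow_const 2).aestronglyMeasurable]
    exact integral_prod _ hq2
  have hv : ∫ x, ∇ f x ∂ν = ∫ x, ∫ y, q x y ∂μ ∂μ := by
    rw [hν, integral_map (by fun_prop) (measurable_gradient f).aestronglyMeasurable]
    exact integral_prod _ hq1
  -- By Fubini, almost every section, and then the averaged function, is again admissible for the
  -- inequality of `μ`.
  have hdd : ∀ᵐ x ∂μ, ∀ᵐ y ∂μ, DifferentiableAt ℝ f (c • (x + y)) := by
    rw [hν] at hd
    exact Measure.ae_ae_of_ae_prod (ae_of_ae_map (by fun_prop) hd)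
  have hgL : LipschitzWith (L * ‖c‖₊) (fun x => ∫ y, f (c • (x + y)) ∂μ) :=
    lipschitzWith_integral
      (fun x => ((hf.comp_const_smul_add c x).memLp_two hμ).integrable (by norm_num)) (fun y => by
        simp_rw [fun x => add_comm x y]
        exact hf.comp_const_smul_add c y)
  have hgrad : ∀ᵐ x ∂μ, HasGradientAt (fun x => ∫ y, f (c • (x + y)) ∂μ)
      (c • ∫ y, q x y ∂μ) x := hdd.mono fun x hx => hasGradientAt_integral_const_smul_add hμ hf c hx
  have hproj : variance (fun x => ∫ y, f (c • (x + y)) ∂μ) μ ≤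
      K * (c ^ 2 * ∫ x, ‖∫ y, q x y ∂μ‖ ^ 2 ∂μ) := by
    refine (hK _ _ hgL (hgrad.mono fun x hx => hx.differentiableAt)).trans_eq ?_
    rw [← integral_const_mul (c ^ 2)]
    congr 1
    refine integral_congr_ae (hgrad.mono fun x hx => ?_)
    simp only [hx.gradient, norm_smul, mul_pow, Real.norm_eq_abs, sq_abs]
  have hsec : ∫ x, variance (fun y => f (c • (x + y))) μ ∂μ ≤
      K * (c ^ 2 * ∫ x, ∫ y, ‖q x y‖ ^ 2 ∂μ ∂μ) := by
    rw [← integral_const_mul (c ^ 2), ← integral_const_mul K]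
    refine integral_mono_of_nonneg (.of_forall fun x => variance_nonneg _ _)
      ((hq2.integral_prod_left.const_mul _).const_mul _) (hdd.mono fun x hx => ?_)
    refine (hK _ _ (hf.comp_const_smul_add c x)
      (hx.mono fun y hy => DifferentiableAt.comp y hy (by fun_prop))).trans_eq ?_
    beta_reduce
    rw [← integral_const_mul (c ^ 2)]
    simp only [gradient_const_smul_add, norm_smul, mul_pow, Real.norm_eq_abs, sq_abs, hq]
  have hsym := two_mul_integral_norm_integral_sq_le (μ := μ) hqm.stronglyMeasurable hqB
    (fun x y => by simp only [hq, add_comm])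
  rw [he, hv, hν, variance_map_const_smul_add hμ hf]
  nlinarith [mul_le_mul_of_nonneg_left hsym (mul_nonneg hK0 (sq_nonneg c))]

end Convolution

/-! ### Lower semicontinuity of the variance. -/

section EVariance

variable {α : Type*} [MeasurableSpace α] {μ : Measure α} [IsProbabilityMeasure μ]

theorem lintegral_enorm_sub_const_sq {f : α → ℝ} (hf : MemLp f 2 μ) (c : ℝ) :
    ∫⁻ x, ‖f x - c‖ₑ ^ 2 ∂μ = evariance f μ + ‖c - ∫ x, f x ∂μ‖ₑ ^ 2 := by
  have h1 : Integrable f μ := hf.integrable (by norm_num)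
  have h2 : MemLp (fun x => f x - c) 2 μ := hf.sub (memLp_const c)
  have h3 : ∀ t : ℝ, ‖t‖ₑ ^ 2 = ENNReal.ofReal (t ^ 2) := fun t => by
    rw [← sq_abs, ENNReal.ofReal_pow (abs_nonneg t), ← Real.norm_eq_abs, ofReal_norm]
  simp_rw [h3]
  rw [← ofReal_integral_eq_lintegral_ofReal h2.integrable_sq (.of_forall fun x => sq_nonneg _),
    ← ofReal_variance hf, ← ENNReal.ofReal_add (variance_nonneg _ _) (sq_nonneg _)]
  congr 1
  have h4 := variance_eq_sub h2
  rw [variance_sub_const hf.aestronglyMeasurable, integral_sub h1 (integrable_const c)] at h4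
  simp only [Pi.pow_apply, integral_const, probReal_univ, one_smul] at h4
  rw [h4]
  ring

/-- This form of the variance contains no mean, so Fatou applies to it directly. Outside `L²` every
inner integral is infinite. -/
theorem lintegral_lintegral_enorm_sub_sq {f : α → ℝ} (hf : Measurable f) :
    ∫⁻ y, ∫⁻ x, ‖f x - f y‖ₑ ^ 2 ∂μ ∂μ = 2 * evariance f μ := by
  by_cases h : MemLp f 2 μ
  · simp_rw [fun y => lintegral_enorm_sub_const_sq h (f y)]
    rw [lintegral_add_left measurable_const]
    simp [evariance, two_mul]
  · rw [evariance_eq_top hf.aestronglyMeasurable h]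
    have h1 : ∀ y, ∫⁻ x, ‖f x - f y‖ₑ ^ 2 ∂μ = ∞ := fun y => by
      by_contra hne
      apply h
      have h2 : MemLp (fun x => f x - f y) 2 μ := by
        refine ⟨by fun_prop, ?_⟩
        rw [eLpNorm_lt_top_iff_lintegral_rpow_enorm_lt_top (by norm_num) (by norm_num)]
        simpa using lt_top_iff_ne_top.2 hne
      exact (h2.add (memLp_const (f y))).ae_eq (.of_forall fun x => sub_add_cancel _ _)
    simp [h1]

/-- Fatou's lemma for the variance. -/
theorem evariance_le_liminf {f : α → ℝ} {g : ℕ → α → ℝ} (hf : Measurable f)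
    (hg : ∀ n, Measurable (g n)) (h : ∀ x, Tendsto (fun n => g n x) atTop (𝓝 (f x))) :
    evariance f μ ≤ liminf (fun n => evariance (g n) μ) atTop := by
  have key : 2 * evariance f μ ≤ liminf (fun n => 2 * evariance (g n) μ) atTop := by
    rw [← lintegral_lintegral_enorm_sub_sq hf]
    simp_rw [fun n => (lintegral_lintegral_enorm_sub_sq (μ := μ) (hg n)).symm]
    have h1 : ∀ y x, ‖f x - f y‖ₑ ^ 2 = liminf (fun n => ‖g n x - g n y‖ₑ ^ 2) atTop :=
      fun y x => (((ENNReal.continuous_pow 2).tendsto _).comp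
        ((continuous_enorm.tendsto _).comp ((h x).sub (h y)))).liminf_eq.symm
    simp_rw [h1]
    calc _ ≤ ∫⁻ y, liminf (fun n => ∫⁻ x, ‖g n x - g n y‖ₑ ^ 2 ∂μ) atTop ∂μ :=
          lintegral_mono fun y => lintegral_liminf_le fun n =>
            (((hg n).sub_const _).enorm.pow_const 2)
      _ ≤ _ := lintegral_liminf_le fun n => by
          have := hg n
          refine Measurable.lintegral_prod_right' (f := fun z : α × α => ‖g n z.2 - g n z.1‖ₑ ^ 2) ?_
          fun_prop
  rw [ENNReal.liminf_const_mul_of_ne_top (by norm_num)] at key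
  exact (ENNReal.mul_le_mul_iff_right (by norm_num) (by norm_num)).1 key

end EVariance

/-! ### Approximation of locally Lipschitz functions by Lipschitz ones. -/

section Truncation

theorem LipschitzWith.mul_of_bounded {α : Type*} [PseudoMetricSpace α] {f g : α → ℝ}
    {K L A B : ℝ≥0} (hf : LipschitzWith K f) (hg : LipschitzWith L g) (hA : ∀ x, |f x| ≤ A)
    (hB : ∀ x, |g x| ≤ B) : LipschitzWith (A * L + B * K) (fun x => f x * g x) := by
  refine LipschitzWith.of_dist_le_mul fun x y => ?_
  have h1 := hf.dist_le_mul x y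
  have h2 := hg.dist_le_mul x y
  rw [Real.dist_eq] at *
  calc |f x * g x - f y * g y| = |f x * (g x - g y) + g y * (f x - f y)| := by ring_nf
    _ ≤ |f x| * |g x - g y| + |g y| * |f x - f y| := by
        simpa [abs_mul] using abs_add_le (f x * (g x - g y)) (g y * (f x - f y))
    _ ≤ A * (L * dist x y) + B * (K * dist x y) := by
        gcongr
        exacts [hA x, hB y]
    _ = _ := by push_cast; ring

theorem tendsto_mul_sin_div (t : ℝ) :
    Tendsto (fun n : ℕ => ((n : ℝ) + 1) * Real.sin (t / (n + 1))) atTop (𝓝 t) := by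
  have h1 : HasDerivAt (fun s : ℝ => Real.sin (t * s)) t 0 := by
    simpa using ((hasDerivAt_id (0 : ℝ)).const_mul t).sin
  have h2 : Tendsto (fun n : ℕ => 1 / ((n : ℝ) + 1)) atTop (𝓝[>] 0) :=
    tendsto_nhdsWithin_iff.2 ⟨tendsto_one_div_add_atTop_nhds_zero_nat,
      .of_forall fun n => Set.mem_Ioi.2 (by positivity)⟩
  refine (h1.tendsto_slope_zero_right.comp h2).congr fun n => ?_
  simp [div_eq_mul_inv]

variable {E : Type*} [NormedAddCommGroup E] [InnerProductSpace ℝ E] [FiniteDimensional ℝ E]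

/-- A locally Lipschitz function is a pointwise limit of Lipschitz functions whose gradients
are, wherever that of the function exists, at most slightly longer. -/
theorem LocallyLipschitz.exists_lipschitz_approximation {f : E → ℝ} (hf : LocallyLipschitz f) :
    ∃ (M : ℝ≥0) (g : ℕ → E → ℝ), (∀ n, ∃ L, LipschitzWith L (g n)) ∧
      (∀ n x, DifferentiableAt ℝ f x → DifferentiableAt ℝ (g n) x ∧
        ‖∇ (g n) x‖ ≤ ‖∇ f x‖ + M / (n + 1)) ∧
      ∀ x, Tendsto (fun n => g n x) atTop (𝓝 (f x)) := by
  let χ : ContDiffBump (0 : E) := ⟨1, 2, one_pos, one_lt_two⟩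
  obtain ⟨M, hM⟩ := ContDiff.lipschitzWith_of_hasCompactSupport χ.hasCompactSupport
    (χ.contDiff (n := 1)) one_ne_zero
  have hχ1 : ∀ x, |χ x| ≤ (1 : ℝ≥0) := fun x => by
    rw [abs_of_nonneg χ.nonneg]
    exact χ.le_one
  -- The sine caps `f` at height `n + 1` without losing differentiability or lengthening gradients.
  -- The cutoff lives at the larger scale `(n + 1)²`, so its gradient contributes only `(n + 1) * M
  -- / (n + 1)² = M / (n + 1)`.
  set s : ℕ → E → ℝ := fun n x => χ ((((n : ℝ) + 1) ^ 2)⁻¹ • x)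
  set w : ℕ → (E → ℝ) → E → ℝ := fun n f x => ((n : ℝ) + 1) * Real.sin (f x / (n + 1)) with hw
  have hsL : ∀ n : ℕ, LipschitzWith (M * ‖(((n : ℝ) + 1) ^ 2)⁻¹‖₊) (s n) := fun n =>
    hM.comp (lipschitzWith_smul _)
  have hwB : ∀ (n : ℕ) h x, |w n h x| ≤ (n + 1 : ℝ≥0) := fun n h x => by
    simp only [hw, abs_mul]
    rw [abs_of_nonneg (by positivity : (0 : ℝ) ≤ n + 1)]
    push_cast
    exact mul_le_of_le_one_right (by positivity) (Real.abs_sin_le_one _)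
  have hwL : ∀ (n : ℕ) h L, LipschitzWith L h → LipschitzWith L (w n h) := fun n h L hL => by
    refine LipschitzWith.of_dist_le_mul fun x y => ?_
    have h1 := hL.dist_le_mul x y
    have h2 := Real.lipschitzWith_sin.dist_le_mul (h x / (n + 1)) (h y / (n + 1))
    rw [Real.dist_eq] at *
    have h3 : (0 : ℝ) < n + 1 := by positivity
    rw [Real.dist_eq, ← sub_div, abs_div, abs_of_pos h3] at h2
    simp only [hw, ← mul_sub, abs_mul, abs_of_pos h3]
    refine le_trans ?_ h1
    calc _ ≤ ((n : ℝ) + 1) * (1 * (|h x - h y| / (n + 1))) := by gcongr; simpa using h2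
      _ = _ := by field_simp
  refine ⟨M, fun n x => s n x * w n f x, fun n => ?_, fun n x hx => ?_, fun x => ?_⟩
  · have hc : IsCompact (Metric.closedBall (0 : E) (2 * ((n : ℝ) + 1) ^ 2)) :=
      isCompact_closedBall _ _
    obtain ⟨L, hL⟩ := LocallyLipschitzOn.exists_lipschitzOnWith_of_compact hc
      (locallyLipschitzOn_univ.2 hf |>.mono (Set.subset_univ _))
    -- `f` is Lipschitz on the ball carrying the cutoff. Swapping it for a global Lipschitz
    -- extension leaves the product unchanged.
    obtain ⟨h, hhL, hh⟩ := hL.extend_real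
    have heq : (fun x => s n x * w n f x) = fun x => s n x * w n h x := by
      ext x
      by_cases hx : x ∈ Metric.closedBall (0 : E) (2 * ((n : ℝ) + 1) ^ 2)
      · simp only [hw, hh hx]
      · have h0 : s n x = 0 := by
          apply χ.zero_of_le_dist
          rw [mem_closedBall_zero_iff, not_le] at hx
          rw [dist_zero_right, norm_smul, norm_inv, Real.norm_of_nonneg (by positivity),
            le_inv_mul_iff₀ (by positivity), mul_comm]
          exact hx.le
        simp [h0]
    exact ⟨_, heq ▸ (hsL n).mul_of_bounded (hwL n h L hhL) (fun x => hχ1 _) (hwB n h)⟩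
  · have hk : (0 : ℝ) < n + 1 := by positivity
    have hsd : DifferentiableAt ℝ (s n) x :=
      ((χ.contDiff (n := 1)).differentiable one_ne_zero).differentiableAt.comp x (by fun_prop)
    have hwd : HasFDerivAt (w n f) (Real.cos (f x / (n + 1)) • fderiv ℝ f x) x := by
      have h1 := ((hx.hasFDerivAt.mul_const (((n : ℝ) + 1)⁻¹)).sin).const_mul ((n : ℝ) + 1)
      simp only [← div_eq_mul_inv] at h1
      refine h1.congr_fderiv ?_
      rw [smul_smul, smul_smul]
      congr 1
      field_simp
    have hprod : HasFDerivAt (fun x => s n x * w n f x) _ x := hsd.hasFDerivAt.mul hwd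
    refine ⟨hprod.differentiableAt, ?_⟩
    beta_reduce
    rw [norm_gradient_eq_norm_fderiv, norm_gradient_eq_norm_fderiv, hprod.fderiv]
    refine (norm_add_le _ _).trans (add_le_add ?_ ?_)
    · rw [norm_smul, norm_smul, Real.norm_eq_abs, Real.norm_eq_abs]
      have h1 : |s n x| ≤ 1 := hχ1 _
      have h2 := Real.abs_cos_le_one (f x / (n + 1))
      calc _ ≤ 1 * (1 * ‖fderiv ℝ f x‖) := by gcongr
        _ = _ := by ring
    · rw [norm_smul, Real.norm_eq_abs]
      have h1 : ‖fderiv ℝ (s n) x‖ ≤ M * ((n + 1 : ℝ) ^ 2)⁻¹ := by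
        refine (norm_fderiv_le_of_lipschitz ℝ (hsL n)).trans_eq ?_
        push_cast
        rw [Real.norm_of_nonneg (by positivity)]
      have h2 := hwB n f x
      push_cast at h2
      calc _ ≤ ((n : ℝ) + 1) * (M * ((n + 1 : ℝ) ^ 2)⁻¹) := by gcongr
        _ = _ := by field_simp
  · refine (tendsto_mul_sin_div (f x)).congr' ?_
    filter_upwards [eventually_ge_atTop ⌈‖x‖⌉₊] with n hn
    have h1 : s n x = 1 := by
      apply χ.one_of_mem_closedBall
      have h2 : ‖x‖ ≤ n := (Nat.le_ceil _).trans (by exact_mod_cast hn)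
      rw [mem_closedBall_zero_iff, norm_smul, norm_inv, Real.norm_of_nonneg (by positivity),
        inv_mul_le_iff₀ (by positivity)]
      change ‖x‖ ≤ _ * 1
      nlinarith [norm_nonneg x]
    simp [h1, hw]

end Truncation

/-! ### From Lipschitz to locally Lipschitz test functions. -/

section Extension

variable {d : ℕ} {μ : Measure (EuclideanSpace ℝ (Fin d))} [IsProbabilityMeasure μ]

/-- Along the truncations, Fatou handles the variance and dominated convergence the energy. -/
theorem LipschitzPoincare.satisfiesPoincare (hμ : MemLp id 2 μ) {C : ℝ≥0}
    (h : LipschitzPoincare μ C) : SatisfiesPoincare μ C := by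
  intro f hf hd
  obtain ⟨M, g, hgL, hgd, hg⟩ := hf.exists_lipschitz_approximation
  have hE : ∀ n, evariance (g n) μ ≤ C * ∫⁻ x, (‖∇ f x‖ₑ + (M / (n + 1) : ℝ≥0)) ^ 2 ∂μ := by
    intro n
    obtain ⟨L, hL⟩ := hgL n
    have h1 := h (g n) L hL (hd.mono fun x hx => (hgd n x hx).1)
    rw [← ofReal_variance (hL.memLp_two hμ)]
    refine (ENNReal.ofReal_le_ofReal h1).trans ?_
    rw [ENNReal.ofReal_mul (by positivity), ENNReal.ofReal_coe_nnreal,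
      ← hL.lintegral_enorm_gradient_sq]
    gcongr C * ?_
    refine lintegral_mono_ae (hd.mono fun x hx => ?_)
    gcongr
    have h2 := ENNReal.ofReal_le_ofReal (hgd n x hx).2
    rw [ENNReal.ofReal_add (by positivity) (by positivity), ofReal_norm, ofReal_norm] at h2
    refine h2.trans_eq ?_
    congr 1
    rw [← ENNReal.ofReal_coe_nnreal]
    push_cast
    rfl
  have hF := evariance_le_liminf (μ := μ) hf.continuous.measurable
    (fun n => (hgL n).choose_spec.continuous.measurable) hg
  -- In `[0, ∞]`, `0 * ∞ = 0`, so for `C = 0` infinite energy does not make the inequality trivial.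
  rcases eq_or_ne C 0 with rfl | hC
  · simp only [ENNReal.coe_zero, zero_mul, nonpos_iff_eq_zero] at hE
    simpa [hE] using hF
  by_cases he : ∫⁻ x, ‖∇ f x‖ₑ ^ 2 ∂μ = ∞
  · simp [he, ENNReal.mul_top, hC]
  refine hF.trans ((liminf_le_liminf (.of_forall hE)).trans_eq ?_)
  refine Tendsto.liminf_eq (ENNReal.Tendsto.const_mul ?_ (.inr ENNReal.coe_ne_top))
  have hm : Measurable fun x => ‖∇ f x‖ₑ := (measurable_gradient f).enorm
  refine tendsto_lintegral_of_dominated_convergence (fun x => 2 * (‖∇ f x‖ₑ ^ 2 + (M : ℝ≥0∞) ^ 2))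
    (fun n => by fun_prop) (fun n => .of_forall fun x => ?_) ?_ (.of_forall fun x => ?_)
  · have h1 : ((M / (n + 1) : ℝ≥0) : ℝ≥0∞) ≤ M :=
      ENNReal.coe_le_coe.2 (div_le_self (by positivity) (by simp))
    calc (‖∇ f x‖ₑ + (M / (n + 1) : ℝ≥0)) ^ 2 ≤ (‖∇ f x‖ₑ + M) ^ 2 := by gcongr
      _ ≤ _ := by
        beta_reduce
        rw [enorm_eq_nnnorm]
        exact_mod_cast (add_sq_le : (‖∇ f x‖₊ + M) ^ 2 ≤ 2 * (‖∇ f x‖₊ ^ 2 + M ^ 2))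
  · rw [lintegral_const_mul _ (by fun_prop), lintegral_add_right _ measurable_const]
    simp [ENNReal.mul_eq_top, he]
  · have h1 : Tendsto (fun n : ℕ => (M / (n + 1) : ℝ≥0)) atTop (𝓝 0) := by
      have h2 := (NNReal.tendsto_coe.2 (tendsto_const_nhds (x := M) (f := atTop (α := ℕ)))).mul
        (tendsto_one_div_add_atTop_nhds_zero_nat (𝕜 := ℝ))
      rw [← NNReal.tendsto_coe]
      simpa [div_eq_mul_inv] using h2
    have h3 := (ENNReal.tendsto_coe.2 h1).const_add ‖∇ f x‖ₑ
    simpa [Function.comp_def] using ((ENNReal.continuous_pow 2).tendsto _).comp h3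

end Extension

/-! ### Invariance of the directional variance. -/

section Variance

/-- By Fubini some section `y ↦ a x + a y` is in `L²`; subtract the constant. This settles the case
of infinite variance. -/
theorem memLp_of_memLp_prod_add {α : Type*} [MeasurableSpace α] {μ : Measure α}
    [IsProbabilityMeasure μ] {a : α → ℝ} (ha : Measurable a)
    (h : MemLp (fun z : α × α => a z.1 + a z.2) 2 (μ.prod μ)) : MemLp a 2 μ := by
  have h1 := h.integrable_sq
  obtain ⟨x, hx⟩ := ((integrable_prod_iff h1.aestronglyMeasurable).1 h1).1.exists
  have h2 : MemLp (fun y => a x + a y) 2 μ :=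
    (memLp_two_iff_integrable_sq (by fun_prop)).2 hx
  exact (h2.sub (memLp_const (a x))).ae_eq (.of_forall fun y => by simp)

theorem evariance_prod_const_mul_add {α : Type*} [MeasurableSpace α] {μ : Measure α}
    [IsProbabilityMeasure μ] {a : α → ℝ} (ha : Measurable a) {c : ℝ} (hc : c ^ 2 = 1 / 2) :
    evariance (fun z : α × α => c * (a z.1 + a z.2)) (μ.prod μ) = evariance a μ := by
  have hc0 : c ≠ 0 := by
    rintro rfl
    norm_num at hc
  by_cases h : MemLp a 2 μ
  · have h1 : MemLp (fun z : α × α => c * (a z.1 + a z.2)) 2 (μ.prod μ) :=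
      ((h.comp_fst μ).add (h.comp_snd μ)).const_mul c
    rw [← ofReal_variance h, ← ofReal_variance h1, variance_const_mul]
    have h2 := variance_add_prod h h
    rw [h2, hc]
    congr 1
    ring
  · rw [evariance_eq_top (by fun_prop) h, evariance_eq_top (by fun_prop)]
    intro h1
    refine h (memLp_of_memLp_prod_add ha ?_)
    simpa [← mul_assoc, hc0] using h1.const_mul c⁻¹

theorem evariance_map {α β : Type*} [MeasurableSpace α] [MeasurableSpace β] {ν : Measure α}
    {T : α → β} (hT : Measurable T) {f : β → ℝ} (hf : Measurable f) :
    evariance f (ν.map T) = evariance (fun x => f (T x)) ν := by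
  simp only [evariance]
  rw [lintegral_map (by fun_prop) hT, integral_map hT.aemeasurable (by fun_prop)]

variable {d : ℕ} {μ : Measure (EuclideanSpace ℝ (Fin d))} [IsProbabilityMeasure μ]

theorem maxDirectionalVariance_map_const_smul_add {c : ℝ} (hc : c ^ 2 = 1 / 2) :
    maxDirectionalVariance ((μ.prod μ).map fun p => c • (p.1 + p.2)) =
      maxDirectionalVariance μ := by
  unfold maxDirectionalVariance
  congr! 3 with α hα
  rw [evariance_map (by fun_prop) (by fun_prop)]
  simp_rw [inner_smul_right, inner_add_right]
  exact evariance_prod_const_mul_add (a := fun x => ⟪α, x⟫) (by fun_prop) hc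

theorem variance_inner_le (h : maxDirectionalVariance μ ≠ ∞)
    (v : EuclideanSpace ℝ (Fin d)) :
    variance (fun x => ⟪v, x⟫) μ ≤ (maxDirectionalVariance μ).toReal * ‖v‖ ^ 2 := by
  rcases eq_or_ne v 0 with rfl | hv
  · simp [variance, evariance]
  have hv' : ‖v‖ ≠ 0 := norm_ne_zero_iff.2 hv
  have h1 : evariance (fun x => ⟪‖v‖⁻¹ • v, x⟫) μ ≤ maxDirectionalVariance μ :=
    le_iSup₂_of_le (‖v‖⁻¹ • v) (by simp [norm_smul, hv']) le_rfl
  have h2 := ENNReal.toReal_mono h h1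
  change variance _ μ ≤ _ at h2
  simp_rw [real_inner_smul_left] at h2
  rw [variance_const_mul, inv_pow, inv_mul_le_iff₀ (by positivity)] at h2
  linarith

end Variance

/-! ### Mean gradient of nearly extremal functions. -/

section Deficit

variable {d : ℕ} {ν : Measure (EuclideanSpace ℝ (Fin d))} [IsProbabilityMeasure ν]

/-- Perturbing `f` by the linear function along its mean gradient bounds the mean gradient of
a function that nearly saturates the Poincaré inequality. -/
theorem LipschitzPoincare.sq_sub_cov_le (hν : MemLp id 2 ν) {C : ℝ} (hC : LipschitzPoincare ν C)
    {f : EuclideanSpace ℝ (Fin d) → ℝ} {L : ℝ≥0} (hf : LipschitzWith L f)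
    (hd : ∀ᵐ x ∂ν, DifferentiableAt ℝ f x) (v : EuclideanSpace ℝ (Fin d))
    (hv : v = ∫ x, ∇ f x ∂ν) :
    (C * ‖v‖ ^ 2 - covariance f (fun x => ⟪v, x⟫) ν) ^ 2 ≤
      (C * ∫ x, ‖∇ f x‖ ^ 2 ∂ν - variance f ν) *
        (C * ‖v‖ ^ 2 - variance (fun x => ⟪v, x⟫) ν) := by
  set ℓ : EuclideanSpace ℝ (Fin d) → ℝ := fun x => ⟪v, x⟫
  have hfL : MemLp f 2 ν := hf.memLp_two hν
  have hℓL : MemLp ℓ 2 ν := (innerSL ℝ v).lipschitz.memLp_two hν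
  have hg2 := (hf.memLp_gradient (μ := ν) 2).integrable_norm_pow (by norm_num)
  have hg1 := (hf.memLp_gradient (μ := ν) 2).integrable (by norm_num)
  -- This quadratic in `t` is the Poincaré deficit of `f + t ℓ`; its discriminant gives the claim.
  -- Since `v` is the mean gradient, the cross term of the energy is `2 t ‖v‖²`.
  have key : ∀ t : ℝ, 0 ≤ (C * ‖v‖ ^ 2 - variance ℓ ν) * (t * t) +
      2 * (C * ‖v‖ ^ 2 - covariance f ℓ ν) * t +
      (C * ∫ x, ‖∇ f x‖ ^ 2 ∂ν - variance f ν) := by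
    intro t
    have hgrad : ∀ x, DifferentiableAt ℝ f x →
        HasGradientAt (fun x => f x + ⟪t • v, x⟫) (∇ f x + t • v) x := fun x hx => by
      have h1 := hx.hasGradientAt.hasFDerivAt.add (hasGradientAt_inner_const (t • v) x).hasFDerivAt
      rw [← map_add] at h1
      exact hasGradientAt_iff_hasFDerivAt.2 h1
    have h2 := hC _ _ (hf.add_inner_const (t • v))
      (hd.mono fun x hx => (hgrad x hx).differentiableAt)
    have h3 : ∫ x, ‖∇ (fun x => f x + ⟪t • v, x⟫) x‖ ^ 2 ∂ν =
        ∫ x, ‖∇ f x‖ ^ 2 ∂ν + 2 * t * ‖v‖ ^ 2 + t ^ 2 * ‖v‖ ^ 2 := by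
      rw [integral_congr_ae (hd.mono fun x hx => by rw [(hgrad x hx).gradient])]
      simp_rw [norm_add_sq_real, inner_smul_right, fun x => real_inner_comm v (∇ f x)]
      have h4 : Integrable (fun x => 2 * (t * ⟪v, ∇ f x⟫)) ν :=
        ((hg1.const_inner v).const_mul t).const_mul 2
      refine (integral_add (hg2.add h4) (integrable_const _)).trans ?_
      rw [integral_add' hg2 h4, integral_const_mul,
        integral_const_mul, integral_inner hg1, ← hv, real_inner_self_eq_norm_sq]
      simp [norm_smul, mul_pow]
      ring
    have h5 : variance (fun x => f x + ⟪t • v, x⟫) ν =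
        variance f ν + 2 * t * covariance f ℓ ν + t ^ 2 * variance ℓ ν := by
      simp_rw [real_inner_smul_left]
      rw [variance_fun_add hfL (hℓL.const_mul t), variance_const_mul, covariance_const_mul_right]
      ring
    rw [h3, h5] at h2
    nlinarith
  have := discrim_le_zero key
  rw [discrim] at this
  nlinarith

theorem sq_cov_le {f g : EuclideanSpace ℝ (Fin d) → ℝ} (hf : MemLp f 2 ν)
    (hg : MemLp g 2 ν) : covariance f g ν ^ 2 ≤ variance f ν * variance g ν := by
  have key : ∀ t : ℝ, 0 ≤ variance g ν * (t * t) + 2 * covariance f g ν * t + variance f ν := by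
    intro t
    have h := variance_nonneg (fun x => f x + t * g x) ν
    rw [variance_fun_add hf (hg.const_mul t), variance_const_mul, covariance_const_mul_right] at h
    nlinarith
  have := discrim_le_zero key
  rw [discrim] at this
  nlinarith

end Deficit

/-! ### Real inequalities. -/

section Scalar

/-- Here `V, e, n, s, k` stand for the variance and the energy of a function, the squared norm of
its mean gradient, the variance of the linear function along it, and the covariance of the two. -/
theorem four_mul_le_of_near_extremal {C C₁ C₂ S V e n s k : ℝ} (hC : 0 ≤ C) (hCC : C < C₂)
    (hC₁ : 0 ≤ C₁) (hS : 0 ≤ S) (he : 0 ≤ e) (hn : 0 ≤ n) (hs : 0 ≤ s)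
    (hV1 : C * e < V) (hV2 : V ≤ C₂ * e) (hd : (C₂ * n - k) ^ 2 ≤ (C₂ * e - V) * (C₂ * n - s))
    (hk : k ^ 2 ≤ V * s) (hsS : s ≤ S * n) (hV : V ≤ C₁ / 4 * (3 * e + n)) :
    4 * C ≤ C₁ * (3 + (√S + √(C₂ - C)) ^ 2 / C₂) := by
  have hC₂ : 0 < C₂ := hC.trans_lt hCC
  have he' : 0 < e := by
    rcases he.eq_or_lt with h | h
    · rw [← h] at hV1 hV2
      linarith
    · exact h
  have hδ : 0 ≤ C₂ - C := by linarith
  set A := √(C₂ * e * n) with hA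
  set T := √S + √(C₂ - C) with hT
  have h1 : |C₂ * n - k| ≤ √(C₂ - C) * A := by
    rw [hA, ← Real.sqrt_mul hδ]
    refine Real.abs_le_sqrt (hd.trans ?_)
    have h2 : (C₂ * e - V) * (C₂ * n - s) ≤ (C₂ * e - V) * (C₂ * n) :=
      mul_le_mul_of_nonneg_left (by linarith) (by linarith)
    have h3 : (C₂ * e - V) * (C₂ * n) ≤ ((C₂ - C) * e) * (C₂ * n) :=
      mul_le_mul_of_nonneg_right (by linarith) (by positivity)
    linarith
  have h2 : |k| ≤ √S * A := by
    rw [hA, ← Real.sqrt_mul hS]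
    refine Real.abs_le_sqrt (hk.trans ?_)
    calc V * s ≤ (C₂ * e) * (S * n) := mul_le_mul hV2 hsS hs (by positivity)
      _ = _ := by ring
  -- Triangle inequality `C₂ n ≤ |C₂ n - k| + |k|`. Squaring and cancelling `C₂ n` then bounds `n /
  -- e` by `T² / C₂`.
  have h3 : C₂ * n ≤ T * A := by
    rw [hT, add_mul]
    linarith [le_abs_self (C₂ * n - k), le_abs_self k]
  have hA2 : A ^ 2 = C₂ * e * n := Real.sq_sqrt (by positivity)
  have h4 : C₂ * n ≤ e * T ^ 2 := by
    rcases hn.eq_or_lt with h | h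
    · rw [← h]
      simp only [mul_zero]
      positivity
    · have h5 : (C₂ * n) ^ 2 ≤ (T * A) ^ 2 := pow_le_pow_left₀ (by positivity) h3 2
      rw [mul_pow T, hA2] at h5
      have h6 : (C₂ * n) * (C₂ * n) ≤ (C₂ * n) * (e * T ^ 2) := by linarith
      exact le_of_mul_le_mul_left h6 (by positivity)
  have h5 : n ≤ e * (T ^ 2 / C₂) := by
    rw [← mul_div_assoc, le_div_iff₀ hC₂]
    linarith
  have h6 : C₁ / 4 * (3 * e + n) ≤ C₁ / 4 * (3 * e + e * (T ^ 2 / C₂)) := by gcongr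
  have h7 : (4 * C) * e ≤ (C₁ * (3 + T ^ 2 / C₂)) * e := by linarith
  exact le_of_mul_le_mul_right h7 he'

/-- The hypothesis is `X ≤ C₁ - C₁ / 4 * (1 - S / X)`, and `1 - S / X` dominates the fraction: after
clearing denominators the gap is `(X - S) S²`. -/
theorem le_sub_of_four_mul_le {C₁ X S : ℝ} (hC₁ : 0 ≤ C₁) (hX : 0 < X) (hS : 0 ≤ S) (hSX : S ≤ X)
    (h : 4 * X ≤ C₁ * (3 + S / X)) :
    X ≤ C₁ - C₁ / 4 * ((X - S) ^ 2 / ((X - S) ^ 2 + X * S)) := by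
  have hD : 0 < (X - S) ^ 2 + X * S := by nlinarith [sq_nonneg (X - S), mul_nonneg hX.le hS]
  have h1 : (X - S) ^ 2 / ((X - S) ^ 2 + X * S) ≤ 1 - S / X := by
    rw [div_le_iff₀ hD, one_sub_div hX.ne', div_mul_eq_mul_div, le_div_iff₀ hX]
    nlinarith [mul_nonneg (sub_nonneg.2 hSX) (sq_nonneg S)]
  nlinarith [mul_le_mul_of_nonneg_left h1 hC₁]

end Scalar

/-! ### Comparison of the two Poincaré constants. -/

section Main

variable {d : ℕ}

theorem maxDirectionalVariance_le_poincareConstant {μ : Measure (EuclideanSpace ℝ (Fin d))}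
    [IsProbabilityMeasure μ] : maxDirectionalVariance μ ≤ poincareConstant μ :=
  le_iInf₂ fun _ h => maxDirectionalVariance_le_of_satisfiesPoincare h

variable {μ ν : Measure (EuclideanSpace ℝ (Fin d))} [IsProbabilityMeasure μ]
  [IsProbabilityMeasure ν] {c : ℝ}

/-- The bound `K / 4 * (3 e + n)` is at most `K e`, because `n ≤ e` by Jensen. -/
theorem LipschitzPoincare.map_const_smul_add (hμ : MemLp id 2 μ) {K : ℝ}
    (hK : LipschitzPoincare μ K) (hK0 : 0 ≤ K) (hc : c ^ 2 = 1 / 2)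
    (hν : ν = (μ.prod μ).map fun p => c • (p.1 + p.2)) : LipschitzPoincare ν K := by
  intro f L hf hd
  have h1 := variance_map_const_smul_add_le hμ hK hK0 hf c hν hd
  have h2 := norm_integral_sq_le (hf.memLp_gradient (μ := ν) 2)
  rw [hc] at h1
  nlinarith [mul_le_mul_of_nonneg_left h2 hK0]

theorem exists_lipschitz_lt_variance (hν : MemLp id 2 ν) {C : ℝ} (hC : 0 ≤ C)
    (h : ENNReal.ofReal C < poincareConstant ν) :
    ∃ (f : EuclideanSpace ℝ (Fin d) → ℝ) (L : ℝ≥0), LipschitzWith L f ∧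
      (∀ᵐ x ∂ν, DifferentiableAt ℝ f x) ∧ C * ∫ x, ‖∇ f x‖ ^ 2 ∂ν < variance f ν := by
  by_contra! hne
  lift C to ℝ≥0 using hC
  have h1 : LipschitzPoincare ν C := hne
  rw [ENNReal.ofReal_coe_nnreal] at h
  exact absurd h (not_lt.2 (poincareConstant_le (h1.satisfiesPoincare hν)))

theorem four_mul_poincareConstant_le (hμ : MemLp id 2 μ) (hνL : MemLp id 2 ν) {K : ℝ}
    (hK : LipschitzPoincare μ K) (hK0 : 0 ≤ K) (hc : c ^ 2 = 1 / 2)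
    (hν : ν = (μ.prod μ).map fun p => c • (p.1 + p.2)) (hC₂ : poincareConstant ν ≠ ∞)
    (hpos : 0 < (poincareConstant ν).toReal) :
    4 * (poincareConstant ν).toReal ≤
      K * (3 + (maxDirectionalVariance ν).toReal / (poincareConstant ν).toReal) := by
  set C₂ := (poincareConstant ν).toReal
  set S := (maxDirectionalVariance ν).toReal
  have hC : ∀ C, 0 ≤ C → C < C₂ → 4 * C ≤ K * (3 + (√S + √(C₂ - C)) ^ 2 / C₂) := by
    intro C hC0 hlt
    have hlt' : ENNReal.ofReal C < poincareConstant ν :=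
      (ENNReal.ofReal_lt_iff_lt_toReal hC0 hC₂).2 hlt
    obtain ⟨f, L, hf, hd, hV⟩ := exists_lipschitz_lt_variance hνL hC0 hlt'
    have hP := lipschitzPoincare_poincareConstant hC₂
    have hfL := hf.memLp_two hνL
    set v := ∫ x, ∇ f x ∂ν with hv
    have hℓL : MemLp (fun x : EuclideanSpace ℝ (Fin d) => ⟪v, x⟫) 2 ν :=
      (innerSL ℝ v).lipschitz.memLp_two hνL
    have h1 := variance_map_const_smul_add_le hμ hK hK0 hf c hν hd
    rw [hc] at h1
    refine four_mul_le_of_near_extremal hC0 hlt hK0 ENNReal.toReal_nonneg (by positivity)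
      (sq_nonneg ‖v‖) (variance_nonneg _ _) hV (hP f L hf hd) (hP.sq_sub_cov_le hνL hf hd v hv)
      (sq_cov_le hfL hℓL) (variance_inner_le ?_ v) (h1.trans_eq (by ring))
    exact ne_top_of_le_ne_top hC₂ maxDirectionalVariance_le_poincareConstant
  -- An extremal function need not exist, so the bound for near-extremal ones is passed to the limit
  -- `C ↑ C₂`.
  have hlim : ContinuousAt (fun C => K * (3 + (√S + √(C₂ - C)) ^ 2 / C₂)) C₂ := by fun_prop
  have hS0 : √S ^ 2 = S := Real.sq_sqrt ENNReal.toReal_nonneg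
  have h1 := hlim.tendsto
  simp only [sub_self, Real.sqrt_zero, add_zero, hS0] at h1
  refine le_of_tendsto_of_tendsto ((tendsto_id.const_mul 4).mono_left nhdsWithin_le_nhds)
    (h1.mono_left (nhdsWithin_le_nhds (s := Set.Iio C₂))) ?_
  filter_upwards [Ioo_mem_nhdsLT hpos] with C hC'
  exact hC C hC'.1.le hC'.2

end Main

theorem mainTheorem8 {d : ℕ} {Ω : Type*} [MeasurableSpace Ω]
    (P : Measure Ω) [IsProbabilityMeasure P]
    (X₁ X₂ : Ω → EuclideanSpace ℝ (Fin d))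
    (ν₁ ν₂ : Measure (EuclideanSpace ℝ (Fin d)))
    (hX₁ : HasLaw X₁ ν₁ P) (hX₂ : HasLaw X₂ ν₁ P) (hindep : IndepFun X₁ X₂ P)
    (hsum : HasLaw (fun ω => (1 / √2 : ℝ) • (X₁ ω + X₂ ω)) ν₂ P) :
    maxDirectionalVariance ν₂ = maxDirectionalVariance ν₁ ∧
    (poincareConstant ν₁ ≠ ∞ →
      poincareConstant ν₂ ≠ ∞ ∧
      maxDirectionalVariance ν₁ ≠ ∞ ∧
      ∀ C₁ C₂ σsq : ℝ,
        C₁ = (poincareConstant ν₁).toReal →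
        C₂ = (poincareConstant ν₂).toReal →
        σsq = (maxDirectionalVariance ν₁).toReal →
        C₂ ≤ C₁ - C₁ / 4 * ((C₂ - σsq) ^ 2 / ((C₂ - σsq) ^ 2 + C₂ * σsq))) := by
  have hp₁ : IsProbabilityMeasure ν₁ :=
    hX₁.map_eq ▸ Measure.isProbabilityMeasure_map hX₁.aemeasurable
  have hp₂ : IsProbabilityMeasure ν₂ :=
    hsum.map_eq ▸ Measure.isProbabilityMeasure_map hsum.aemeasurable
  have hc : (1 / √2 : ℝ) ^ 2 = 1 / 2 := by
    rw [div_pow, Real.sq_sqrt (by norm_num), one_pow]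
  have hν : ν₂ = (ν₁.prod ν₁).map fun p => (1 / √2 : ℝ) • (p.1 + p.2) := by
    have h1 := (indepFun_iff_map_prod_eq_prod_map_map hX₁.aemeasurable hX₂.aemeasurable).1 hindep
    rw [hX₁.map_eq, hX₂.map_eq] at h1
    rw [← h1, AEMeasurable.map_map_of_aemeasurable (by fun_prop)
      (hX₁.aemeasurable.prodMk hX₂.aemeasurable)]
    exact hsum.map_eq.symm
  have hσ : maxDirectionalVariance ν₂ = maxDirectionalVariance ν₁ := by
    rw [hν]
    exact maxDirectionalVariance_map_const_smul_add hc
  refine ⟨hσ, fun hfin => ?_⟩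
  obtain ⟨K, hK⟩ : ∃ K : ℝ≥0, SatisfiesPoincare ν₁ K := by
    by_contra! h
    exact hfin (by simp [poincareConstant, h])
  have hμ := hK.memLp_id
  have hνL : MemLp id 2 ν₂ := hν ▸ map_const_smul_add_memLp_id hμ _
  have hP := lipschitzPoincare_poincareConstant hfin
  have h0 : 0 ≤ (poincareConstant ν₁).toReal := ENNReal.toReal_nonneg
  have hle : poincareConstant ν₂ ≤ poincareConstant ν₁ := by
    have h1 : LipschitzPoincare ν₂ ((poincareConstant ν₁).toNNReal : ℝ≥0) :=
      hP.map_const_smul_add hμ h0 hc hν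
    exact (poincareConstant_le (h1.satisfiesPoincare hνL)).trans_eq (ENNReal.coe_toNNReal hfin)
  have hfin₂ := ne_top_of_le_ne_top hfin hle
  have hS := maxDirectionalVariance_le_poincareConstant (μ := ν₂)
  refine ⟨hfin₂, hσ ▸ ne_top_of_le_ne_top hfin₂ hS, ?_⟩
  rintro _ _ _ rfl rfl rfl
  have hSX := ENNReal.toReal_mono hfin₂ hS
  have hXC := ENNReal.toReal_mono hfin hle
  rw [← hσ]
  -- If `C₂ = 0` then `σ² = 0` as well, and the fraction is `0 / 0 = 0`.
  rcases (ENNReal.toReal_nonneg (a := poincareConstant ν₂)).eq_or_lt with h | h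
  · have hS0 : (maxDirectionalVariance ν₂).toReal = 0 :=
      le_antisymm (hSX.trans h.ge) ENNReal.toReal_nonneg
    rw [← h, hS0]
    simp
  · exact le_sub_of_four_mul_le h0 h ENNReal.toReal_nonneg hSX
      (four_mul_poincareConstant_le hμ hνL hP h0 hc hν hfin₂ h)
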